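/- For integers $1\le l\le n$ let the rational numbers $P^{(l)}(n)$ be defined by $P^{(n)}(n)=\frac{6^n}{(2n+1)!}$ for $n\ge 1$ and, for $1<l\le n$, $$P^{(n-l+1)}(n)=6^n\,\frac{l-1}{2n-l}\sum_{i=l-1}^{n-1}\frac{2n-2i-1}{(2n-2i+1)!}\,\frac{P^{(i-l+2)}(i)}{6^i}.$$ (Thus $P^{(1)}(n)=\frac1n$, $P^{(2)}(n)=\frac{3}{10}$, $P^{(3)}(n)=\frac{3(21n-43)}{1400}$, $P^{(4)}(n)=\frac{63n^2-387n+590}{14000}$, and so on.) For $i\ge 1$ and real $z$ put $$C_i(z)=\sum_{n=1}^{\infty}\frac{(-1)^{n+1}\,n(n+1)\,P^{(i)}(n+i-1)}{(2n+2i-3)(2n+2i-2)(2n+2i-1)(2n+2i)}\;z^{2n},$$ and let $$a_i=C_i\Big(\tfrac{\ln(3/2)}{2\sqrt6}\Big),\qquad b_i=C_i\Big(\tfrac{\ln(4/3)}{2\sqrt6}\Big),\qquad c_i=C_i\Big(\tfrac{\ln(9/8)}{2\sqrt6}\Big).$$ Then the series defining $a_i$, $b_i$, $c_i$ converge for every $i\ge1$,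 the three series over $i$ below converge, and $$\begin{aligned} \zeta(3)={}&\tfrac{2\pi^2}{5}\ln 3-\tfrac{54}{5}\ln^2\tfrac32-\tfrac{27}{5}\ln^2\tfrac43+\tfrac95\ln^2\tfrac98 -\tfrac65\ln^3\tfrac32+\ln^3\tfrac43+\tfrac15\ln^3\tfrac98\\ &+\tfrac{28}{5}\ln^3 2-\tfrac45\ln^3 3-\tfrac45\ln^3\tfrac32 +\tfrac{12}{5}\ln 3\,\ln^2\tfrac32-\tfrac{24}{5}\ln\tfrac43\,\ln^2 2\\ &+\tfrac{36}{5}\ln^2\tfrac32\;\ln\ln\tfrac32+\tfrac{18}{5}\ln^2\tfrac43\;\ln\ln\tfrac43-\tfrac65\ln^2\tfrac98\;\ln\ln\tfrac98\\ &+\tfrac{1728}{5}\sum_{i=1}^\infty a_i\Big(\tfrac{\ln(3/2)}{2\sqrt6}\Big)^{2i} +\tfrac{864}{5}\sum_{i=1}^\infty b_i\Big(\tfrac{\ln(4/3)}{2\sqrt6}\Big)^{2i} -\tfrac{288}{5}\sum_{i=1}^\infty c_i\Big(\tfrac{\ln(9/8)}{2\sqrt6}\Big)^{2i}. \end{aligned}$$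 Here $\ln^k x=(\ln x)^k$. -/

import Mathlib

open scoped Nat

noncomputable section

/-- `zetaPDiag k n` is the value `P^{(n - k)}(n)` for `k < n`: the initial value is
`P^{(n)}(n) = 6 ^ n / (2 n + 1)!`, and with `l = k + 1 > 1` the recursion is
`P^{(n-l+1)}(n) = 6^n (l-1)/(2n-l) ∑_{i=l-1}^{n-1} (2(n-i)-1)/(2(n-i)+1)! * P^{(i-l+2)}(i)/6^i`. -/
def zetaPDiag : ℕ → ℕ → ℝ
  | 0, n => 6 ^ n / ((2 * n + 1)! : ℝ)
  | k + 1, n =>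
      6 ^ n * (((k : ℝ) + 1) / (2 * (n : ℝ) - ((k : ℝ) + 2))) *
        ∑ i ∈ Finset.Ico (k + 1) n,
          (2 * ((n : ℝ) - (i : ℝ)) - 1) / ((2 * (n - i) + 1)! : ℝ) * (zetaPDiag k i / 6 ^ i)

/-- The values `P^{(l)}(n)`, for `1 ≤ l ≤ n`, of the P-polynomials. -/
def zetaP (l n : ℕ) : ℝ := zetaPDiag (n - l) n

/-- The first P-polynomial is `P^{(1)}(n) = 1 / n`. -/
theorem zetaP_one (n : ℕ) (hn : 1 ≤ n) : zetaP 1 n = 1 / (n : ℝ) := by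
  obtain ⟨k, rfl⟩ : ∃ k, n = k + 1 := ⟨n - 1, by omega⟩
  unfold zetaP
  rw [Nat.add_sub_cancel]
  clear hn
  induction k with
  | zero => norm_num [zetaPDiag, Nat.factorial]
  | succ k ih =>
    have h6 : ((6 : ℝ) ^ (k + 1)) ≠ 0 := by positivity
    have h1 : (k : ℝ) + 1 ≠ 0 := by positivity
    have h2 : (k : ℝ) + 2 ≠ 0 := by positivity
    have hs : k + 1 + 1 - (k + 1) = 1 := by omega
    rw [zetaPDiag, Nat.Ico_succ_singleton, Finset.sum_singleton, ih, hs]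
    have h3 : 2 * (((k + 1 + 1 : ℕ) : ℝ)) - ((k : ℝ) + 2) = (k : ℝ) + 2 := by
      push_cast; ring
    rw [h3, pow_succ]
    push_cast
    norm_num [Nat.factorial]
    field_simp
    ring

/-- The `n`-th term (`n ≥ 1`) of the series that defines the `i`-th coefficient at `z`. -/
def zetaCoeffTerm (z : ℝ) (i n : ℕ) : ℝ :=
  (-1) ^ (n + 1) * (n : ℝ) * ((n : ℝ) + 1) * zetaP i (n + i - 1) /
    ((2 * (n : ℝ) + 2 * (i : ℝ) - 3) * (2 * (n : ℝ) + 2 * (i : ℝ) - 2) *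
      (2 * (n : ℝ) + 2 * (i : ℝ) - 1) * (2 * (n : ℝ) + 2 * (i : ℝ))) * z ^ (2 * n)

/-- The `i`-th coefficient (`i ≥ 1`) at `z`, the sum of its series over `n = 1, 2, …`. -/
def zetaCoeff (z : ℝ) (i : ℕ) : ℝ := ∑' n : ℕ, zetaCoeffTerm z i (n + 1)

/-- The argument `ln(x) / (2 √6)`. -/
def zetaArg (x : ℝ) : ℝ := Real.log x / (2 * √6)

/-- The coefficients `a_i`. -/
def zetaA (i : ℕ) : ℝ := zetaCoeff (zetaArg (3 / 2)) i

/-- The coefficients `b_i`. -/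
def zetaB (i : ℕ) : ℝ := zetaCoeff (zetaArg (4 / 3)) i

/-- The coefficients `c_i`. -/
def zetaC (i : ℕ) : ℝ := zetaCoeff (zetaArg (9 / 8)) i

end

/-! The numbers $P^{(l)}(n)$ are disguised Taylor coefficients. With $u(w)=\sum_j w^j/(2j+3)!$, so
that $u(t^2)=(\sinh t-t)/t^3$, one has $P^{(i+1)}(n+1+i)=\frac{6^{n+1+i}}{n+1}[w^i]u^{n+1}$
(`zetaP_eq_coeff`). Expanding $1/\sinh^2t$ in powers of $(\sinh t-t)/t$ therefore turns
$1/t^2-1/\sinh^2t$ into a double series in these numbers (`hasSum_cschCoeff`). The four linear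
factors in the denominator of $C_i$ come from integrating it four times, that is, against
$(y-t)^3/6$ on $[0,y]$.

The same integral has a closed form (`integral_sub_pow_three_mul_csch`): the primitives of
$1/t^2-1/\sinh^2t$ run through $\coth t-1/t$ and $\ln(\sinh t/t)$ to $\mathrm{Li}_2(e^{-2t})$ and
$\mathrm{Li}_3(e^{-2t})$. At $y=\frac12\ln x$ each series over $i$ becomes
$(\zeta(3)-\mathrm{Li}_3(1/x))/24$ plus elementary terms (`hasSum_zetaCoeff_log`).

For $x=3/2,4/3,9/8$ this leaves $6\,\mathrm{Li}_3(2/3)+3\,\mathrm{Li}_3(3/4)-\mathrm{Li}_3(8/9)$,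
which trilogarithm functional equations reduce to $\frac{91}{12}\zeta(3)$ plus elementary terms
(`trilog_two_thirds_combination`). The total coefficient of $\zeta(3)$ is then
$\frac{96}5-\frac{91}5=1$. -/

/-! ### Polylogarithms on $[-1,1]$ -/

/-- The real polylogarithm of integer order, defined by its power series on `[-1, 1]`. -/
noncomputable def polylog (s : ℕ) (x : ℝ) : ℝ := ∑' n : ℕ, x ^ (n + 1) / ((n : ℝ) + 1) ^ s

theorem polylog_zero_right (s : ℕ) : polylog s 0 = 0 := by
  simp [polylog]

theorem summable_one_div_succ_pow {s : ℕ} (hs : 2 ≤ s) :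
    Summable fun n : ℕ => 1 / ((n : ℝ) + 1) ^ s := by
  have h := (summable_nat_add_iff 1).2 (Real.summable_one_div_nat_pow.2 (show 1 < s by omega))
  simpa using h

theorem norm_polylog_term_le (s : ℕ) {x : ℝ} (hx : x ∈ Set.Icc (-1 : ℝ) 1) (n : ℕ) :
    ‖x ^ (n + 1) / ((n : ℝ) + 1) ^ s‖ ≤ 1 / ((n : ℝ) + 1) ^ s := by
  rw [norm_div, norm_pow, Real.norm_eq_abs, Real.norm_of_nonneg (by positivity)]
  gcongr
  exact pow_le_one₀ (abs_nonneg x) (abs_le.2 hx)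

theorem summable_polylog_term {s : ℕ} (hs : 2 ≤ s) {x : ℝ} (hx : x ∈ Set.Icc (-1 : ℝ) 1) :
    Summable fun n : ℕ => x ^ (n + 1) / ((n : ℝ) + 1) ^ s :=
  .of_norm_bounded (summable_one_div_succ_pow hs) (norm_polylog_term_le s hx)

theorem continuousOn_polylog {s : ℕ} (hs : 2 ≤ s) :
    ContinuousOn (polylog s) (Set.Icc (-1) 1) :=
  continuousOn_tsum (fun n => by fun_prop) (summable_one_div_succ_pow hs)
    fun n x hx => norm_polylog_term_le s hx n

theorem hasDerivAt_polylog (s : ℕ) {x : ℝ} (hx : |x| < 1) (hx0 : x ≠ 0) :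
    HasDerivAt (polylog (s + 1)) (polylog s x / x) x := by
  -- On the ball of radius $r$ the termwise derivatives are dominated by the geometric series $\sum
  -- r^n$.
  obtain ⟨r, hxr, hr1⟩ := exists_between hx
  have hr0 : 0 ≤ r := (abs_nonneg x).trans hxr.le
  have key := hasDerivAt_tsum_of_isPreconnected (𝕜 := ℝ) (u := fun n : ℕ => r ^ n)
    (g := fun n y => y ^ (n + 1) / ((n : ℝ) + 1) ^ (s + 1))
    (g' := fun n y => y ^ n / ((n : ℝ) + 1) ^ s) (t := Metric.ball (0 : ℝ) r)
    (summable_geometric_of_lt_one hr0 hr1) Metric.isOpen_ball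
    (convex_ball (0 : ℝ) r).isPreconnected
    (fun n y _ => by
      refine ((hasDerivAt_pow (n + 1) y).div_const (((n : ℝ) + 1) ^ (s + 1))).congr_deriv ?_
      have : (n : ℝ) + 1 ≠ 0 := by positivity
      push_cast
      field_simp
      ring)
    (fun n y hy => by
      rw [mem_ball_zero_iff, Real.norm_eq_abs] at hy
      rw [norm_div, norm_pow, Real.norm_eq_abs, Real.norm_of_nonneg (by positivity)]
      have h1 : |y| ^ n ≤ r ^ n := by gcongr
      have h2 : (1 : ℝ) ≤ ((n : ℝ) + 1) ^ s := one_le_pow₀ (by linarith [n.cast_nonneg (α := ℝ)])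
      exact (div_le_self (by positivity) h2).trans h1)
    (y₀ := 0) (y := x) (by simpa using (abs_nonneg x).trans_lt hxr)
    (by simp) (by simpa using hxr)
  refine HasDerivAt.congr_deriv (f := polylog (s + 1)) key ?_
  rw [polylog, ← tsum_div_const]
  congr 1
  ext n
  field_simp
  ring

theorem polylog_one_left {x : ℝ} (hx : |x| < 1) : polylog 1 x = -Real.log (1 - x) := by
  simpa [polylog] using (Real.hasSum_pow_div_log_of_abs_lt_one hx).tsum_eq

theorem polylog_two_one : polylog 2 1 = Real.pi ^ 2 / 6 := by
  have h := (hasSum_nat_add_iff' 1).2 hasSum_zeta_two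
  simpa [polylog] using h.tsum_eq

theorem riemannZeta_eq_polylog_one {s : ℕ} (hs : 1 < s) :
    riemannZeta s = ((polylog s 1 : ℝ) : ℂ) := by
  have h := zeta_nat_eq_tsum_of_gt_one hs
  have hsum : Summable fun n : ℕ => 1 / (n : ℂ) ^ s := by
    exact_mod_cast (Complex.summable_one_div_nat_cpow (p := (s : ℂ))).2 (by simpa using hs)
  rw [h, hsum.tsum_eq_zero_add, polylog, Complex.ofReal_tsum]
  simp [show s ≠ 0 by omega]

theorem polylog_add_polylog_neg {s : ℕ} (hs : 2 ≤ s) {x : ℝ} (hx : x ∈ Set.Icc (-1 : ℝ) 1) :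
    polylog s x + polylog s (-x) = 2 / 2 ^ s * polylog s (x ^ 2) := by
  have hx' : -x ∈ Set.Icc (-1 : ℝ) 1 := ⟨by linarith [hx.2], by linarith [hx.1]⟩
  have hx2 : x ^ 2 ∈ Set.Icc (-1 : ℝ) 1 := ⟨by nlinarith, by nlinarith [hx.1, hx.2]⟩
  have h3 := (summable_polylog_term hs hx).hasSum.add (summable_polylog_term hs hx').hasSum
  have h4 := (summable_polylog_term hs hx2).hasSum.mul_left (2 / 2 ^ s)
  have h5 : HasSum (fun n : ℕ => x ^ (n + 1) / ((n : ℝ) + 1) ^ s +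
      (-x) ^ (n + 1) / ((n : ℝ) + 1) ^ s) (0 + 2 / 2 ^ s * polylog s (x ^ 2)) := by
    refine HasSum.even_add_odd ?_ ?_
    -- The index starts at $0$ but the exponent at $1$, so even indices carry the odd powers, which
    -- cancel.
    · refine hasSum_zero.congr_fun fun n => ?_
      rw [Odd.neg_pow (by simp)]
      ring
    · refine h4.congr_fun fun n => ?_
      have h6 : ((2 * n + 1 : ℕ) : ℝ) + 1 = 2 * ((n : ℝ) + 1) := by push_cast; ring
      have h7 : 2 * n + 1 + 1 = 2 * (n + 1) := by ring
      rw [h6, h7, Even.neg_pow (even_two_mul _), mul_pow, ← pow_mul]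
      have : (n : ℝ) + 1 ≠ 0 := by positivity
      field_simp
      ring
  rw [zero_add] at h5
  exact h3.unique h5

/-- Engine of all the functional equations below. Only continuity is needed at the ends, so the
constant can be read off at $0$ or $1$, where a polylogarithm argument may sit at $\pm1$ or $0$. -/
theorem eq_of_hasDerivAt_zero {f : ℝ → ℝ} {a b : ℝ} (hab : a ≤ b)
    (hc : ContinuousOn f (Set.Icc a b)) (hd : ∀ x ∈ Set.Ioo a b, HasDerivAt f 0 x) :
    f a = f b := by
  rcases hab.eq_or_lt with rfl | h
  · rfl
  obtain ⟨c, -, h2⟩ := exists_hasDerivAt_eq_slope f (fun _ => 0) h hc hd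
  have : b - a ≠ 0 := by linarith
  field_simp at h2
  linarith

theorem HasDerivAt.polylog {s : ℕ} {g : ℝ → ℝ} {g' x : ℝ} (hg : HasDerivAt g g' x)
    (h1 : |g x| < 1) (h0 : g x ≠ 0) :
    HasDerivAt (fun y => polylog (s + 1) (g y)) (polylog s (g x) / g x * g') x :=
  (hasDerivAt_polylog s h1 h0).comp x hg

theorem ContinuousOn.polylog {s : ℕ} (hs : 2 ≤ s) {g : ℝ → ℝ} {t : Set ℝ}
    (hg : ContinuousOn g t) (h : ∀ x ∈ t, g x ∈ Set.Icc (-1 : ℝ) 1) :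
    ContinuousOn (fun y => polylog s (g y)) t :=
  (continuousOn_polylog hs).comp hg h

/-! ### The numbers $P^{(l)}(n)$ as coefficients of powers of $u$ -/

/-- The power series `∑ w ^ j / (2 j + 3)!`, so that `sinh x = x + x ^ 3 * u (x ^ 2)`. -/
noncomputable def sinhTail : PowerSeries ℝ := PowerSeries.mk fun j => 1 / ((2 * j + 3)! : ℝ)

theorem coeff_sinhTail (j : ℕ) : PowerSeries.coeff j sinhTail = 1 / ((2 * j + 3)! : ℝ) :=
  PowerSeries.coeff_mk _ _

theorem coeff_sinhTail_pow_nonneg (n i : ℕ) : 0 ≤ PowerSeries.coeff i (sinhTail ^ n) := by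
  induction n generalizing i with
  | zero =>
    rw [pow_zero, PowerSeries.coeff_one]
    split_ifs <;> norm_num
  | succ n ih =>
    rw [pow_succ, PowerSeries.coeff_mul]
    refine Finset.sum_nonneg fun p _ => mul_nonneg (ih _) ?_
    rw [coeff_sinhTail]
    positivity

/-- Compare coefficients of $w^i$ in $u^{k+1}(u+2wu')=u^{k+2}+\frac{2}{k+2}\,w\,(u^{k+2})'$. The
factor $u+2wu'$ has coefficients $(2m+1)/(2m+3)!$, exactly the weights in the recursion for $P$. -/
theorem coeff_sinhTail_pow_succ (k i : ℕ) :
    ((k : ℝ) + 2 + 2 * i) / (k + 2) * PowerSeries.coeff i (sinhTail ^ (k + 2)) =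
      ∑ j ∈ Finset.range (i + 1), PowerSeries.coeff j (sinhTail ^ (k + 1)) *
        ((2 * ((i - j : ℕ) : ℝ) + 1) / ((2 * (i - j) + 3)! : ℝ)) := by
  have hX : ∀ (f : PowerSeries ℝ) (j : ℕ),
      PowerSeries.coeff j (PowerSeries.X * PowerSeries.derivative ℝ f) =
        j * PowerSeries.coeff j f := by
    intro f j
    cases j with
    | zero => simp
    | succ j =>
      rw [mul_comm, PowerSeries.coeff_succ_mul_X]
      simp [PowerSeries.coeff_derivative, mul_comm]
  have h1 : sinhTail ^ (k + 1) *
      (sinhTail + 2 * (PowerSeries.X * PowerSeries.derivative ℝ sinhTail)) =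
      sinhTail ^ (k + 2) + PowerSeries.C (2 / ((k : ℝ) + 2)) *
        (PowerSeries.X * PowerSeries.derivative ℝ (sinhTail ^ (k + 2))) := by
    have h2 : PowerSeries.derivative ℝ (sinhTail ^ (k + 2)) =
        PowerSeries.C ((k : ℝ) + 2) * (sinhTail ^ (k + 1) *
          PowerSeries.derivative ℝ sinhTail) := by
      rw [Derivation.leibniz_pow, map_add, map_natCast, map_ofNat]
      simp
    have h3 : PowerSeries.C (2 / ((k : ℝ) + 2)) * PowerSeries.C ((k : ℝ) + 2) = 2 := by
      have : (k : ℝ) + 2 ≠ 0 := by positivity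
      rw [← map_mul, div_mul_cancel₀ _ this, map_ofNat]
    rw [h2]
    linear_combination (-PowerSeries.X * sinhTail ^ (k + 1) *
      PowerSeries.derivative ℝ sinhTail) * h3
  have h4 := congrArg (PowerSeries.coeff i) h1
  rw [map_add, PowerSeries.coeff_C_mul, hX, PowerSeries.coeff_mul,
    Finset.Nat.sum_antidiagonal_eq_sum_range_succ_mk] at h4
  have h5 : ((k : ℝ) + 2 + 2 * i) / (k + 2) * PowerSeries.coeff i (sinhTail ^ (k + 2)) =
      PowerSeries.coeff i (sinhTail ^ (k + 2)) +
        2 / ((k : ℝ) + 2) * (i * PowerSeries.coeff i (sinhTail ^ (k + 2))) := by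
    have : (k : ℝ) + 2 ≠ 0 := by positivity
    field_simp
  rw [h5, ← h4]
  refine Finset.sum_congr rfl fun j _ => ?_
  have h6 : (2 : PowerSeries ℝ) = PowerSeries.C 2 := (map_ofNat PowerSeries.C 2).symm
  rw [map_add, h6, PowerSeries.coeff_C_mul, hX, coeff_sinhTail]
  ring

theorem zetaPDiag_eq_coeff (k i : ℕ) :
    zetaPDiag k (k + 1 + i) =
      6 ^ (k + 1 + i) / ((k : ℝ) + 1) * PowerSeries.coeff i (sinhTail ^ (k + 1)) := by
  induction k generalizing i with
  | zero =>
    simp [zetaPDiag, coeff_sinhTail]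
    rw [show 2 * (1 + i) + 1 = 2 * i + 3 by ring]
    ring
  | succ k ih =>
    have h1 := coeff_sinhTail_pow_succ k i
    rw [zetaPDiag, Finset.sum_Ico_eq_sum_range, show k + 1 + 1 + i - (k + 1) = i + 1 by omega]
    have h2 : ∑ j ∈ Finset.range (i + 1),
        (2 * (((k + 1 + 1 + i : ℕ) : ℝ) - ((k + 1 + j : ℕ) : ℝ)) - 1) /
          ((2 * (k + 1 + 1 + i - (k + 1 + j)) + 1)! : ℝ) *
          (zetaPDiag k (k + 1 + j) / 6 ^ (k + 1 + j)) =
        1 / ((k : ℝ) + 1) * (((k : ℝ) + 2 + 2 * i) / (k + 2) *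
          PowerSeries.coeff i (sinhTail ^ (k + 2))) := by
      rw [h1, Finset.mul_sum]
      refine Finset.sum_congr rfl fun j hj => ?_
      have hj' : j ≤ i := by simpa [Nat.lt_succ_iff] using hj
      rw [ih, show 2 * (k + 1 + 1 + i - (k + 1 + j)) + 1 = 2 * (i - j) + 3 by omega]
      push_cast [Nat.cast_sub hj']
      field_simp
      ring
    rw [h2]
    have h3 : (k : ℝ) + 2 + 2 * i ≠ 0 := by positivity
    have h4 : 2 * ((k + 1 + 1 + i : ℕ) : ℝ) - ((k : ℝ) + 2) = k + 2 + 2 * i := by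
      push_cast; ring
    have h5 : (k : ℝ) + 2 ≠ 0 := by positivity
    rw [h4]
    push_cast
    field_simp
    ring

theorem zetaP_eq_coeff (i n : ℕ) :
    zetaP (i + 1) (n + 1 + i) =
      6 ^ (n + 1 + i) / ((n : ℝ) + 1) * PowerSeries.coeff i (sinhTail ^ (n + 1)) := by
  rw [zetaP, show n + 1 + i - (i + 1) = n by omega, zetaPDiag_eq_coeff]

/-! ### Functional equations of the dilogarithm and trilogarithm -/

theorem hasDerivAt_log_comp_one_sub {z : ℝ} (hz : z < 1) :
    HasDerivAt (fun y => Real.log (1 - y)) (-1 / (1 - z)) z :=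
  ((hasDerivAt_id z).const_sub 1).log (by simpa using (sub_pos.2 hz).ne')

theorem hasDerivAt_one_sub_inv {z : ℝ} (hz : z ≠ 0) :
    HasDerivAt (fun y => 1 - y⁻¹) ((z ^ 2)⁻¹) z := by
  simpa using (hasDerivAt_inv hz).const_sub 1

/-- The derivative of the difference vanishes, and every term is $0$ at $z=1$. The bound $z\ge 1/2$
keeps $1-z^{-1}$ in $[-1,0]$. -/
theorem dilog_landen {z : ℝ} (hz : 1 / 2 ≤ z) (hz1 : z ≤ 1) :
    polylog 2 (1 - z) + polylog 2 (1 - z⁻¹) = -(Real.log z ^ 2) / 2 := by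
  have key := eq_of_hasDerivAt_zero
    (f := fun y => polylog 2 (1 - y) + polylog 2 (1 - y⁻¹) + Real.log y ^ 2 / 2) hz1 ?_ ?_
  · simp [polylog_zero_right] at key
    linarith
  · have h0 : ∀ y ∈ Set.Icc z 1, y ≠ 0 := fun y hy => by linarith [hy.1]
    refine ((ContinuousOn.polylog le_rfl (by fun_prop) fun y hy => ?_).add
      (ContinuousOn.polylog le_rfl (by fun_prop (disch := assumption)) fun y hy => ?_)).add
      (by fun_prop (disch := assumption))
    · constructor <;> linarith [hy.1, hy.2]
    · have h2 : 1 ≤ y⁻¹ := (one_le_inv₀ (by linarith [hy.1])).2 hy.2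
      have h3 : y⁻¹ ≤ 2 := inv_le_of_inv_le₀ (by norm_num) (by linarith [hy.1])
      constructor <;> linarith
  · intro y hy
    have hy0 : 0 < y := by linarith [hy.1]
    have h2 : 1 < y⁻¹ := (one_lt_inv₀ hy0).2 hy.2
    have h3 : y⁻¹ < 2 := inv_lt_of_inv_lt₀ (by norm_num) (by linarith [hy.1])
    have a1 : |1 - y| < 1 := abs_lt.2 ⟨by linarith [hy.2], by linarith⟩
    have a2 : |1 - y⁻¹| < 1 := abs_lt.2 ⟨by linarith, by linarith⟩
    have n1 : 1 - y ≠ 0 := by linarith [hy.2]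
    refine (((((hasDerivAt_id' y).const_sub 1).polylog (s := 1) a1 n1).add
      ((hasDerivAt_one_sub_inv hy0.ne').polylog (s := 1) a2 (by linarith))).add
      (((Real.hasDerivAt_log hy0.ne').pow 2).div_const 2)).congr_deriv ?_
    rw [polylog_one_left a1, polylog_one_left a2, sub_sub_cancel, sub_sub_cancel, Real.log_inv]
    have n2 : y - 1 ≠ 0 := by linarith [hy.2]
    have e : 1 - y⁻¹ = (y - 1) / y := by field_simp
    rw [e]
    have n3 : y - 1 = -(1 - y) := by ring
    rw [n3]
    field_simp
    push_cast
    ring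

/-- The delicate point is $z=1$: there $\ln z$ is $z-1$ times a continuous slope, and $s\ln s$ is
continuous at $s=0$. -/
theorem continuousOn_log_mul_log_one_sub :
    ContinuousOn (fun z => Real.log z * Real.log (1 - z)) (Set.Ioi 0) := by
  have h : ∀ z : ℝ, Real.log z * Real.log (1 - z) =
      -(dslope Real.log 1 z * ((1 - z) * Real.log (1 - z))) := fun z => by
    have := sub_smul_dslope Real.log 1 z
    rw [Real.log_one, sub_zero, smul_eq_mul] at this
    rw [← this]
    ring
  simp_rw [h]
  refine ContinuousOn.neg (ContinuousOn.mul ?_ ?_)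
  · refine (continuousOn_dslope (Ioi_mem_nhds one_pos)).2
      ⟨fun z hz => (Real.continuousAt_log (ne_of_gt hz)).continuousWithinAt,
        Real.differentiableAt_log one_ne_zero⟩
  · exact (Real.continuous_mul_log.comp (continuous_const.sub continuous_id)).continuousOn

theorem dilog_reflection {z : ℝ} (hz : 0 < z) (hz1 : z ≤ 1) :
    polylog 2 z + polylog 2 (1 - z) = Real.pi ^ 2 / 6 - Real.log z * Real.log (1 - z) := by
  have key := eq_of_hasDerivAt_zero
    (f := fun y => polylog 2 y + polylog 2 (1 - y) + Real.log y * Real.log (1 - y)) hz1 ?_ ?_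
  · simp [polylog_zero_right, polylog_two_one] at key
    linarith
  · refine ((ContinuousOn.polylog le_rfl continuousOn_id fun y hy => ?_).add
      (ContinuousOn.polylog le_rfl (by fun_prop) fun y hy => ?_)).add
      (continuousOn_log_mul_log_one_sub.mono fun y hy => hz.trans_le hy.1)
    · constructor <;> linarith [hy.1, hy.2, id_eq y]
    · constructor <;> linarith [hy.1, hy.2]
  · intro y hy
    have hy0 : 0 < y := by linarith [hy.1]
    have a1 : |1 - y| < 1 := abs_lt.2 ⟨by linarith [hy.2], by linarith⟩
    have a2 : |y| < 1 := abs_lt.2 ⟨by linarith, by linarith [hy.2]⟩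
    have n1 : 1 - y ≠ 0 := by linarith [hy.2]
    refine (((hasDerivAt_polylog 1 a2 hy0.ne').add
      (((hasDerivAt_id' y).const_sub 1).polylog (s := 1) a1 n1)).add
      ((Real.hasDerivAt_log hy0.ne').mul (hasDerivAt_log_comp_one_sub hy.2))).congr_deriv ?_
    rw [polylog_one_left a1, polylog_one_left a2, sub_sub_cancel]
    field_simp
    ring

theorem trilog_landen {z : ℝ} (hz : 1 / 2 ≤ z) (hz1 : z ≤ 1) :
    polylog 3 z + polylog 3 (1 - z) + polylog 3 (1 - z⁻¹) =
      polylog 3 1 + Real.log z ^ 3 / 6 + Real.pi ^ 2 / 6 * Real.log z -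
        Real.log z ^ 2 * Real.log (1 - z) / 2 := by
  have key := eq_of_hasDerivAt_zero
    (f := fun y => polylog 3 y + polylog 3 (1 - y) + polylog 3 (1 - y⁻¹) - Real.log y ^ 3 / 6
      - Real.pi ^ 2 / 6 * Real.log y + Real.log y * (Real.log y * Real.log (1 - y)) / 2) hz1 ?_ ?_
  · simp [polylog_zero_right] at key
    linarith
  · have h0 : ∀ y ∈ Set.Icc z 1, y ≠ 0 := fun y hy => by linarith [hy.1]
    have hl : ContinuousOn Real.log (Set.Icc z 1) := by fun_prop (disch := assumption)
    refine (((((ContinuousOn.polylog (by norm_num) continuousOn_id fun y hy => ?_).add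
      (ContinuousOn.polylog (by norm_num) (by fun_prop) fun y hy => ?_)).add
      (ContinuousOn.polylog (by norm_num) (by fun_prop (disch := assumption))
        fun y hy => ?_)).sub ((hl.pow 3).div_const 6)).sub (hl.const_mul _)).add
      ((hl.mul (continuousOn_log_mul_log_one_sub.mono fun y hy => ?_)).div_const 2)
    · constructor <;> linarith [hy.1, hy.2, id_eq y]
    · constructor <;> linarith [hy.1, hy.2]
    · have h2 : 1 ≤ y⁻¹ := (one_le_inv₀ (by linarith [hy.1])).2 hy.2
      have h3 : y⁻¹ ≤ 2 := inv_le_of_inv_le₀ (by norm_num) (by linarith [hy.1])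
      constructor <;> linarith
    · exact lt_of_lt_of_le (by linarith) hy.1
  · intro y hy
    have hy0 : 0 < y := by linarith [hy.1]
    have h2 : 1 < y⁻¹ := (one_lt_inv₀ hy0).2 hy.2
    have h3 : y⁻¹ < 2 := inv_lt_of_inv_lt₀ (by norm_num) (by linarith [hy.1])
    have a0 : |y| < 1 := abs_lt.2 ⟨by linarith, by linarith [hy.2]⟩
    have a1 : |1 - y| < 1 := abs_lt.2 ⟨by linarith [hy.2], by linarith⟩
    have a2 : |1 - y⁻¹| < 1 := abs_lt.2 ⟨by linarith, by linarith⟩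
    have n1 : 1 - y ≠ 0 := by linarith [hy.2]
    have hl := Real.hasDerivAt_log hy0.ne'
    refine ((((((hasDerivAt_polylog 2 a0 hy0.ne').add
      (((hasDerivAt_id' y).const_sub 1).polylog (s := 2) a1 n1)).add
      ((hasDerivAt_one_sub_inv hy0.ne').polylog (s := 2) a2 (by linarith))).sub
      ((hl.pow 3).div_const 6)).sub (hl.const_mul _)).add
      ((hl.mul (hl.mul (hasDerivAt_log_comp_one_sub hy.2))).div_const 2)).congr_deriv ?_
    -- Landen and reflection express the other two dilogarithms through $\mathrm{Li}_2(1-y)$, whose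
    -- coefficient in the derivative then vanishes.
    have e1 := dilog_landen (z := y) (by linarith [hy.1]) hy.2.le
    have e2 := dilog_reflection hy0 hy.2.le
    have e3 : polylog 2 (1 - y⁻¹) = -(Real.log y ^ 2) / 2 - polylog 2 (1 - y) := by linarith
    have e4 : polylog 2 y = Real.pi ^ 2 / 6 - Real.log y * Real.log (1 - y) -
      polylog 2 (1 - y) := by linarith
    have e : 1 - y⁻¹ = -(1 - y) / y := by field_simp; ring
    rw [e3, e4, e]
    simp only [Pi.mul_apply]
    field_simp
    push_cast
    ring

theorem hasDerivAt_one_sub_div_one_add {x : ℝ} (hx : 1 + x ≠ 0) :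
    HasDerivAt (fun y => (1 - y) / (1 + y)) (-2 / (1 + x) ^ 2) x := by
  refine (((hasDerivAt_id' x).const_sub 1).div ((hasDerivAt_id' x).const_add 1) hx).congr_deriv ?_
  congr 1
  ring

theorem hasDerivAt_inv_one_add {x : ℝ} (hx : 1 + x ≠ 0) :
    HasDerivAt (fun y => (1 + y)⁻¹) (-1 / (1 + x) ^ 2) x :=
  ((hasDerivAt_id' x).const_add 1).inv hx

theorem hasDerivAt_one_sub_sq (x : ℝ) : HasDerivAt (fun y => 1 - y ^ 2) (-(2 * x)) x := by
  simpa using (hasDerivAt_pow 2 x).const_sub 1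

theorem one_sub_div_one_add_mem_Icc {x : ℝ} (h0 : 0 ≤ x) (h1 : x ≤ 1) :
    (1 - x) / (1 + x) ∈ Set.Icc (0 : ℝ) 1 :=
  ⟨div_nonneg (by linarith) (by linarith), (div_le_one (by linarith)).2 (by linarith)⟩

theorem one_sub_div_one_add_mem_Ioo {x : ℝ} (h0 : 0 < x) (h1 : x < 1) :
    (1 - x) / (1 + x) ∈ Set.Ioo (0 : ℝ) 1 :=
  ⟨div_pos (by linarith) (by linarith), (div_lt_one (by linarith)).2 (by linarith)⟩

theorem continuousOn_polylog_one_sub_div_one_add {s : ℕ} (hs : 2 ≤ s) :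
    ContinuousOn (fun y : ℝ => polylog s ((1 - y) / (1 + y))) (Set.Icc 0 1) := by
  refine ContinuousOn.polylog hs (ContinuousOn.div (by fun_prop) (by fun_prop) fun y hy => ?_)
    fun y hy => ?_
  · linarith [hy.1]
  · have h := one_sub_div_one_add_mem_Icc hy.1 hy.2
    exact ⟨by linarith [h.1], h.2⟩

theorem continuousOn_polylog_neg_one_sub_div_one_add {s : ℕ} (hs : 2 ≤ s) :
    ContinuousOn (fun y : ℝ => polylog s (-((1 - y) / (1 + y)))) (Set.Icc 0 1) := by
  refine ContinuousOn.polylog hs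
    (ContinuousOn.div (by fun_prop) (by fun_prop) fun y hy => ?_).neg fun y hy => ?_
  · linarith [hy.1]
  · have h := one_sub_div_one_add_mem_Icc hy.1 hy.2
    exact ⟨by linarith [h.2], by linarith [h.1]⟩

theorem continuousOn_polylog_inv_one_add {s : ℕ} (hs : 2 ≤ s) :
    ContinuousOn (fun y : ℝ => polylog s (1 + y)⁻¹) (Set.Icc 0 1) := by
  refine ContinuousOn.polylog hs (ContinuousOn.inv₀ (by fun_prop) fun y hy => ?_) fun y hy => ?_
  · linarith [hy.1]
  · have h : 0 ≤ (1 + y)⁻¹ := inv_nonneg.2 (by linarith [hy.1])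
    exact ⟨by linarith, inv_le_one_of_one_le₀ (by linarith [hy.1])⟩

theorem continuousOn_polylog_one_sub {s : ℕ} (hs : 2 ≤ s) :
    ContinuousOn (fun y : ℝ => polylog s (1 - y)) (Set.Icc 0 1) :=
  ContinuousOn.polylog hs (by fun_prop)
    fun y hy => ⟨by linarith [hy.1, hy.2], by linarith [hy.1, hy.2]⟩

theorem continuousOn_polylog_one_sub_sq {s : ℕ} (hs : 2 ≤ s) :
    ContinuousOn (fun y : ℝ => polylog s (1 - y ^ 2)) (Set.Icc 0 1) :=
  ContinuousOn.polylog hs (by fun_prop)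
    fun y hy => ⟨by nlinarith [hy.1, hy.2], by nlinarith [hy.1, hy.2]⟩

theorem continuousOn_log_one_add :
    ContinuousOn (fun y : ℝ => Real.log (1 + y)) (Set.Icc 0 1) :=
  ContinuousOn.log (by fun_prop) fun y hy => by linarith [hy.1]

theorem log_one_sub_one_sub_div_one_add {x : ℝ} (h0 : 0 < x) :
    Real.log (1 - (1 - x) / (1 + x)) = Real.log 2 + Real.log x - Real.log (1 + x) := by
  have h : 1 + x ≠ 0 := by linarith
  rw [show 1 - (1 - x) / (1 + x) = 2 * x / (1 + x) by field_simp; ring,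
    Real.log_div (by positivity) h, Real.log_mul two_ne_zero h0.ne']

theorem log_one_add_one_sub_div_one_add {x : ℝ} (h0 : 0 < x) :
    Real.log (1 - -((1 - x) / (1 + x))) = Real.log 2 - Real.log (1 + x) := by
  have h : 1 + x ≠ 0 := by linarith
  rw [show 1 - -((1 - x) / (1 + x)) = 2 / (1 + x) by field_simp; ring,
    Real.log_div two_ne_zero h]

theorem polylog_neg_one {s : ℕ} (hs : 2 ≤ s) :
    polylog s (-1) = (2 / 2 ^ s - 1) * polylog s 1 := by
  have h := polylog_add_polylog_neg hs (x := 1) (by simp)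
  rw [one_pow] at h
  linarith

/-- Base point $x=1$, where all four arguments vanish. Together with the next identity, based at
$x=0$, it supplies the two relations that kill the derivative in the trilogarithm identity. -/
theorem dilog_one_sub_div_one_add_sub {x : ℝ} (h0 : 0 ≤ x) (h1 : x ≤ 1) :
    polylog 2 ((1 - x) / (1 + x)) - polylog 2 (-((1 - x) / (1 + x))) =
      2 * polylog 2 (1 - x) - polylog 2 (1 - x ^ 2) / 2 := by
  have key := eq_of_hasDerivAt_zero
    (f := fun y => polylog 2 ((1 - y) / (1 + y)) - polylog 2 (-((1 - y) / (1 + y)))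
      - 2 * polylog 2 (1 - y) + polylog 2 (1 - y ^ 2) / 2) h1 ?_ ?_
  · simp [polylog_zero_right] at key
    linarith
  · exact ((((continuousOn_polylog_one_sub_div_one_add le_rfl).sub
      (continuousOn_polylog_neg_one_sub_div_one_add le_rfl)).sub
      ((continuousOn_polylog_one_sub le_rfl).const_mul 2)).add
      ((continuousOn_polylog_one_sub_sq le_rfl).div_const 2)).mono
      (Set.Icc_subset_Icc_left h0)
  · intro y hy
    have hy0 : 0 < y := by linarith [hy.1]
    have hy1 := hy.2
    have hv := one_sub_div_one_add_mem_Ioo hy0 hy1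
    have n0 : 1 + y ≠ 0 := by linarith
    have n1 : 1 - y ≠ 0 := by linarith
    have n2 : 1 - y ^ 2 ≠ 0 := by nlinarith
    have a0 : |(1 - y) / (1 + y)| < 1 := abs_lt.2 ⟨by linarith [hv.1], hv.2⟩
    have a1 : |-((1 - y) / (1 + y))| < 1 := by rwa [abs_neg]
    have a2 : |1 - y| < 1 := abs_lt.2 ⟨by linarith, by linarith⟩
    have a3 : |1 - y ^ 2| < 1 := abs_lt.2 ⟨by nlinarith, by nlinarith⟩
    have hd := hasDerivAt_one_sub_div_one_add n0
    refine ((((hd.polylog (s := 1) a0 hv.1.ne').sub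
      (hd.neg.polylog (s := 1) a1 (neg_ne_zero.2 hv.1.ne'))).sub
      ((((hasDerivAt_id' y).const_sub 1).polylog (s := 1) a2 n1).const_mul 2)).add
      (((hasDerivAt_one_sub_sq y).polylog (s := 1) a3 n2).div_const 2)).congr_deriv ?_
    rw [Pi.neg_apply, polylog_one_left a0, polylog_one_left a1, polylog_one_left a2,
      polylog_one_left a3, log_one_sub_one_sub_div_one_add hy0,
      log_one_add_one_sub_div_one_add hy0, sub_sub_cancel, sub_sub_cancel, Real.log_pow]
    rw [show 1 - y ^ 2 = (1 - y) * (1 + y) by ring]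
    field_simp
    push_cast
    ring

theorem dilog_one_sub_div_one_add_sub' {x : ℝ} (h0 : 0 ≤ x) (h1 : x ≤ 1) :
    polylog 2 ((1 - x) / (1 + x)) - polylog 2 (-((1 - x) / (1 + x))) =
      2 * polylog 2 (1 + x)⁻¹ + polylog 2 (1 - x ^ 2) / 2 + Real.log (1 + x) ^ 2 -
        Real.pi ^ 2 / 6 := by
  have key := eq_of_hasDerivAt_zero
    (f := fun y => polylog 2 ((1 - y) / (1 + y)) - polylog 2 (-((1 - y) / (1 + y)))
      - 2 * polylog 2 (1 + y)⁻¹ - polylog 2 (1 - y ^ 2) / 2 - Real.log (1 + y) ^ 2) h0 ?_ ?_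
  · simp [polylog_neg_one, polylog_two_one] at key
    linarith
  · exact (((((continuousOn_polylog_one_sub_div_one_add le_rfl).sub
      (continuousOn_polylog_neg_one_sub_div_one_add le_rfl)).sub
      ((continuousOn_polylog_inv_one_add le_rfl).const_mul 2)).sub
      ((continuousOn_polylog_one_sub_sq le_rfl).div_const 2)).sub
      (continuousOn_log_one_add.pow 2)).mono (Set.Icc_subset_Icc_right h1)
  · intro y hy
    have hy0 := hy.1
    have hy1 : y < 1 := by linarith [hy.2]
    have hv := one_sub_div_one_add_mem_Ioo hy0 hy1
    have n0 : 1 + y ≠ 0 := by linarith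
    have n1 : 1 - y ≠ 0 := by linarith
    have n2 : 1 - y ^ 2 ≠ 0 := by nlinarith
    have a0 : |(1 - y) / (1 + y)| < 1 := abs_lt.2 ⟨by linarith [hv.1], hv.2⟩
    have a1 : |-((1 - y) / (1 + y))| < 1 := by rwa [abs_neg]
    have a2 : |(1 + y)⁻¹| < 1 := by
      rw [abs_of_pos (by positivity)]
      exact inv_lt_one_of_one_lt₀ (by linarith)
    have a3 : |1 - y ^ 2| < 1 := abs_lt.2 ⟨by nlinarith, by nlinarith⟩
    have hd := hasDerivAt_one_sub_div_one_add n0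
    refine (((((hd.polylog (s := 1) a0 hv.1.ne').sub
      (hd.neg.polylog (s := 1) a1 (neg_ne_zero.2 hv.1.ne'))).sub
      (((hasDerivAt_inv_one_add n0).polylog (s := 1) a2 (inv_ne_zero n0)).const_mul 2)).sub
      (((hasDerivAt_one_sub_sq y).polylog (s := 1) a3 n2).div_const 2)).sub
      ((((hasDerivAt_id' y).const_add 1).log n0).pow 2)).congr_deriv ?_
    rw [Pi.neg_apply, polylog_one_left a0, polylog_one_left a1, polylog_one_left a2,
      polylog_one_left a3, log_one_sub_one_sub_div_one_add hy0,
      log_one_add_one_sub_div_one_add hy0, sub_sub_cancel, Real.log_pow,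
      show 1 - (1 + y)⁻¹ = y / (1 + y) by field_simp; ring, Real.log_div hy0.ne' n0]
    rw [show 1 - y ^ 2 = (1 - y) * (1 + y) by ring]
    field_simp
    push_cast
    ring

/-- The two dilogarithm identities give $\mathrm{Li}_2(1-y)$ and $\mathrm{Li}_2(1/(1+y))$ in terms
of the left-hand difference and $\mathrm{Li}_2(1-y^2)$; after substitution the derivative cancels.
The constant comes from $x=0$. -/
theorem trilog_one_sub_div_one_add_sub {x : ℝ} (h0 : 0 ≤ x) (h1 : x ≤ 1) :
    polylog 3 ((1 - x) / (1 + x)) - polylog 3 (-((1 - x) / (1 + x))) =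
      2 * polylog 3 (1 - x) + 2 * polylog 3 (1 + x)⁻¹ - polylog 3 (1 - x ^ 2) / 2 -
        7 / 4 * polylog 3 1 - Real.log (1 + x) ^ 3 / 3 +
        Real.pi ^ 2 / 6 * Real.log (1 + x) := by
  have key := eq_of_hasDerivAt_zero
    (f := fun y => polylog 3 ((1 - y) / (1 + y)) - polylog 3 (-((1 - y) / (1 + y)))
      - 2 * polylog 3 (1 - y) - 2 * polylog 3 (1 + y)⁻¹ + polylog 3 (1 - y ^ 2) / 2
      + Real.log (1 + y) ^ 3 / 3 - Real.pi ^ 2 / 6 * Real.log (1 + y)) h0 ?_ ?_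
  · simp [polylog_neg_one] at key
    linarith
  · have h3 : 2 ≤ 3 := by norm_num
    exact (((((((continuousOn_polylog_one_sub_div_one_add h3).sub
      (continuousOn_polylog_neg_one_sub_div_one_add h3)).sub
      ((continuousOn_polylog_one_sub h3).const_mul 2)).sub
      ((continuousOn_polylog_inv_one_add h3).const_mul 2)).add
      ((continuousOn_polylog_one_sub_sq h3).div_const 2)).add
      ((continuousOn_log_one_add.pow 3).div_const 3)).sub
      (continuousOn_log_one_add.const_mul _)).mono (Set.Icc_subset_Icc_right h1)
  · intro y hy
    have hy0 := hy.1
    have hy1 : y < 1 := by linarith [hy.2]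
    have hv := one_sub_div_one_add_mem_Ioo hy0 hy1
    have n0 : 1 + y ≠ 0 := by linarith
    have n1 : 1 - y ≠ 0 := by linarith
    have n2 : 1 - y ^ 2 ≠ 0 := by nlinarith
    have a0 : |(1 - y) / (1 + y)| < 1 := abs_lt.2 ⟨by linarith [hv.1], hv.2⟩
    have a1 : |-((1 - y) / (1 + y))| < 1 := by rwa [abs_neg]
    have a2 : |(1 + y)⁻¹| < 1 := by
      rw [abs_of_pos (by positivity)]
      exact inv_lt_one_of_one_lt₀ (by linarith)
    have a3 : |1 - y ^ 2| < 1 := abs_lt.2 ⟨by nlinarith, by nlinarith⟩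
    have a4 : |1 - y| < 1 := abs_lt.2 ⟨by linarith, by linarith⟩
    have hd := hasDerivAt_one_sub_div_one_add n0
    have hl := ((hasDerivAt_id' y).const_add 1).log n0
    refine (((((((hd.polylog (s := 2) a0 hv.1.ne').sub
      (hd.neg.polylog (s := 2) a1 (neg_ne_zero.2 hv.1.ne'))).sub
      ((((hasDerivAt_id' y).const_sub 1).polylog (s := 2) a4 n1).const_mul 2)).sub
      (((hasDerivAt_inv_one_add n0).polylog (s := 2) a2 (inv_ne_zero n0)).const_mul 2)).add
      (((hasDerivAt_one_sub_sq y).polylog (s := 2) a3 n2).div_const 2)).add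
      ((hl.pow 3).div_const 3)).sub (hl.const_mul _)).congr_deriv ?_
    have e1 := dilog_one_sub_div_one_add_sub hy0.le hy1.le
    have e2 := dilog_one_sub_div_one_add_sub' hy0.le hy1.le
    have e3 : polylog 2 (1 - y) = (polylog 2 ((1 - y) / (1 + y)) -
      polylog 2 (-((1 - y) / (1 + y)))) / 2 + polylog 2 (1 - y ^ 2) / 4 := by linarith
    have e4 : polylog 2 (1 + y)⁻¹ = (polylog 2 ((1 - y) / (1 + y)) -
      polylog 2 (-((1 - y) / (1 + y)))) / 2 - polylog 2 (1 - y ^ 2) / 4 -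
      Real.log (1 + y) ^ 2 / 2 + Real.pi ^ 2 / 12 := by linarith
    rw [Pi.neg_apply, e3, e4]
    generalize polylog 2 ((1 - y) / (1 + y)) = A
    generalize polylog 2 (-((1 - y) / (1 + y))) = B
    generalize polylog 2 (1 - y ^ 2) = C
    rw [show 1 - y ^ 2 = (1 - y) * (1 + y) by ring]
    field_simp
    push_cast
    ring

theorem trilog_two_thirds_combination :
    6 * polylog 3 (2 / 3) + 3 * polylog 3 (3 / 4) - polylog 3 (8 / 9) =
      91 / 12 * polylog 3 1 + 4 * Real.log 2 ^ 3 - 6 * Real.log 2 ^ 2 * Real.log 3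
        + 3 * Real.log 2 * Real.log 3 ^ 2 - Real.log 3 ^ 3 / 3
        - Real.pi ^ 2 / 2 * Real.log 2 := by
  have l1 := trilog_landen (z := 2 / 3) (by norm_num) (by norm_num)
  have l2 := trilog_landen (z := 3 / 4) (by norm_num) (by norm_num)
  have l3 := trilog_landen (z := 1 / 2) (by norm_num) (by norm_num)
  have e1 := trilog_one_sub_div_one_add_sub (x := 1 / 3) (by norm_num) (by norm_num)
  have e2 := trilog_one_sub_div_one_add_sub (x := 1 / 2) (by norm_num) (by norm_num)
  have d1 := polylog_add_polylog_neg (s := 3) (x := 1 / 2) (by norm_num)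
    (by constructor <;> norm_num)
  have d2 := polylog_neg_one (s := 3) (by norm_num)
  have h4 : Real.log 4 = 2 * Real.log 2 := by
    rw [show (4 : ℝ) = 2 ^ 2 by norm_num, Real.log_pow]
    norm_num
  norm_num [Real.log_div, h4] at l1 l2 l3 e1 e2 d1 d2
  -- The weights eliminate $\mathrm{Li}_3$ at $\frac13,\frac14,\pm\frac12,-\frac13$ and $-1$.
  linear_combination 2 / 3 * l1 - 2 / 3 * l2 + 5 / 3 * l3 - 2 * e1 - 2 / 3 * e2 -
    8 / 3 * d1 - 5 / 3 * d2

/-! ### Double series for $1/t^2-1/\sinh^2t$ -/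

theorem hasSum_coeff_sinhTail_pow {t : ℝ} (ht : 0 < t) (n : ℕ) :
    HasSum (fun i => PowerSeries.coeff i (sinhTail ^ n) * t ^ (2 * i))
      (((Real.sinh t - t) / t ^ 3) ^ n) := by
  have hnn : ∀ n i : ℕ, 0 ≤ PowerSeries.coeff i (sinhTail ^ n) * t ^ (2 * i) := fun n i =>
    mul_nonneg (coeff_sinhTail_pow_nonneg n i) (by positivity)
  induction n with
  | zero =>
    convert hasSum_single (0 : ℕ) _ using 1
    · simp
    · intro i hi
      simp [PowerSeries.coeff_one, hi]
  | succ n ih =>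
    have h1 : HasSum (fun i => PowerSeries.coeff i sinhTail * t ^ (2 * i))
        ((Real.sinh t - t) / t ^ 3) := by
      have h := ((hasSum_nat_add_iff' 1).2 (Real.hasSum_sinh t)).div_const (t ^ 3)
      simp only [Finset.sum_range_one, mul_zero, zero_add, pow_one, Nat.factorial_one,
        Nat.cast_one, div_one] at h
      refine h.congr_fun fun i => ?_
      rw [coeff_sinhTail, show 2 * (i + 1) + 1 = 2 * i + 3 by ring]
      field_simp
      ring
    have hn1 : Summable fun i => ‖PowerSeries.coeff i sinhTail * t ^ (2 * i)‖ := by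
      refine h1.summable.congr fun i => ?_
      rw [Real.norm_of_nonneg]
      simpa using hnn 1 i
    have hn2 : Summable fun i => ‖PowerSeries.coeff i (sinhTail ^ n) * t ^ (2 * i)‖ :=
      ih.summable.congr fun i => (Real.norm_of_nonneg (hnn n i)).symm
    have hs := (summable_norm_sum_mul_antidiagonal_of_summable_norm hn2 hn1).of_norm.hasSum
    rw [← tsum_mul_tsum_eq_tsum_sum_antidiagonal_of_summable_norm hn2 hn1, ih.tsum_eq,
      h1.tsum_eq, ← pow_succ] at hs
    refine hs.congr_fun fun i => ?_
    rw [pow_succ, PowerSeries.coeff_mul, Finset.sum_mul]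
    refine Finset.sum_congr rfl fun p hp => ?_
    rw [← Finset.HasAntidiagonal.mem_antidiagonal.1 hp]
    ring

theorem sinh_one_lt_two : Real.sinh 1 < 2 := by
  rw [Real.sinh_eq]
  linarith [Real.exp_one_lt_d9, Real.exp_pos (-1)]

/-- The series $u(t^2)$ has nonnegative coefficients, so on $(0,1]$ it is at most its value
$\sinh1-1<1$ at $t=1$. -/
theorem sinh_sub_self_lt {t : ℝ} (h0 : 0 < t) (h1 : t ≤ 1) : Real.sinh t - t < t ^ 3 := by
  have a := hasSum_coeff_sinhTail_pow h0 1
  have b := hasSum_coeff_sinhTail_pow one_pos 1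
  have h := hasSum_le (fun i => mul_le_mul_of_nonneg_left
    ((pow_le_one₀ h0.le h1).trans_eq (one_pow (2 * i)).symm)
    (coeff_sinhTail_pow_nonneg 1 i)) a b
  simp only [pow_one, one_pow, div_one] at h
  rw [div_le_iff₀ (by positivity)] at h
  nlinarith [sinh_one_lt_two, pow_pos h0 3]

/-- The nonnegative double sequence `(n + 2) * [w ^ i] u (w) ^ (n + 1)`. -/
noncomputable def cschCoeff (p : ℕ × ℕ) : ℝ :=
  ((p.1 : ℝ) + 2) * PowerSeries.coeff p.2 (sinhTail ^ (p.1 + 1))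

theorem cschCoeff_nonneg (p : ℕ × ℕ) : 0 ≤ cschCoeff p :=
  mul_nonneg (by positivity) (coeff_sinhTail_pow_nonneg _ _)

theorem hasSum_cschCoeff_fiber {t : ℝ} (h0 : 0 < t) (n : ℕ) :
    HasSum (fun i => cschCoeff (n, i) * t ^ (2 * (n + i)))
      (((n : ℝ) + 2) * ((Real.sinh t - t) / t) ^ (n + 1) / t ^ 2) := by
  have h := (hasSum_coeff_sinhTail_pow h0 (n + 1)).mul_left (((n : ℝ) + 2) * t ^ (2 * n))
  have hv : ((n : ℝ) + 2) * t ^ (2 * n) * ((Real.sinh t - t) / t ^ 3) ^ (n + 1) =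
      ((n : ℝ) + 2) * ((Real.sinh t - t) / t) ^ (n + 1) / t ^ 2 := by
    rw [div_pow, div_pow]
    field_simp
    ring
  rw [hv] at h
  refine h.congr_fun fun i => ?_
  simp only [cschCoeff]
  ring

theorem hasSum_add_two_mul_pow_succ {r : ℝ} (hr : |r| < 1) :
    HasSum (fun n : ℕ => ((n : ℝ) + 2) * r ^ (n + 1)) (1 / (1 - r) ^ 2 - 1) := by
  have h := (hasSum_coe_mul_geometric_of_norm_lt_one (r := r) hr).add
    (hasSum_geometric_of_norm_lt_one (ξ := r) hr)
  have h2 := (hasSum_nat_add_iff' 1).2 h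
  have hr1 : 1 - r ≠ 0 := by linarith [(abs_lt.1 hr).2]
  have hv : r / (1 - r) ^ 2 + (1 - r)⁻¹ - ∑ i ∈ Finset.range 1, ((i : ℝ) * r ^ i + r ^ i) =
      1 / (1 - r) ^ 2 - 1 := by
    simp
    field_simp
    ring
  rw [hv] at h2
  refine h2.congr_fun fun n => ?_
  push_cast
  ring

theorem sinh_sub_self_div_mem {t : ℝ} (h0 : 0 < t) (h1 : t ≤ 1) :
    (Real.sinh t - t) / t ∈ Set.Ico (0 : ℝ) 1 := by
  constructor
  · exact div_nonneg (sub_nonneg.2 (Real.self_le_sinh_iff.2 h0.le)) h0.le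
  · rw [div_lt_one h0]
    have := sinh_sub_self_lt h0 h1
    nlinarith [mul_nonneg h0.le (sub_nonneg.2 h1), mul_nonneg (mul_nonneg h0.le h0.le)
      (sub_nonneg.2 h1)]

theorem summable_cschCoeff {t : ℝ} (h0 : 0 < t) (h1 : t ≤ 1) :
    Summable fun p : ℕ × ℕ => cschCoeff p * t ^ (2 * (p.1 + p.2)) := by
  refine (summable_prod_of_nonneg fun p => mul_nonneg (cschCoeff_nonneg p) (by positivity)).2
    ⟨fun n => (hasSum_cschCoeff_fiber h0 n).summable, ?_⟩
  have hs := sinh_sub_self_div_mem h0 h1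
  simp only [(hasSum_cschCoeff_fiber h0 _).tsum_eq]
  exact (hasSum_add_two_mul_pow_succ (abs_lt.2 ⟨by linarith [hs.1], hs.2⟩)).summable.div_const _

/-- Put $s=(\sinh t-t)/t\in[0,1)$, so $1+s=\sinh t/t$. Summing over the power of $w$ first leaves
$t^{-2}\sum_n(-1)^n(n+2)s^{n+1}=t^{-2}(1-(1+s)^{-2})$. Absolute convergence, from the nonnegative
version, justifies the order of summation. -/
theorem hasSum_cschCoeff {t : ℝ} (h0 : 0 < t) (h1 : t ≤ 1) :
    HasSum (fun p : ℕ × ℕ => (-1) ^ p.1 * (cschCoeff p * t ^ (2 * (p.1 + p.2))))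
      (1 / t ^ 2 - 1 / Real.sinh t ^ 2) := by
  have hsum : Summable fun p : ℕ × ℕ => (-1 : ℝ) ^ p.1 * (cschCoeff p * t ^ (2 * (p.1 + p.2))) := by
    refine .of_norm_bounded (summable_cschCoeff h0 h1) fun p => ?_
    rw [norm_mul, norm_pow, norm_neg, norm_one, one_pow, one_mul, Real.norm_of_nonneg]
    exact mul_nonneg (cschCoeff_nonneg p) (by positivity)
  have hf := hsum.hasSum.prod_fiberwise fun n => (hasSum_cschCoeff_fiber h0 n).mul_left ((-1) ^ n)
  have hs := sinh_sub_self_div_mem h0 h1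
  have hr : |-((Real.sinh t - t) / t)| < 1 := by
    rw [abs_neg]
    exact abs_lt.2 ⟨by linarith [hs.1], hs.2⟩
  have hg := (hasSum_add_two_mul_pow_succ hr).neg.div_const (t ^ 2)
  have hg' := hg.congr_fun (g := fun n : ℕ => (-1) ^ n * (((n : ℝ) + 2) *
    ((Real.sinh t - t) / t) ^ (n + 1) / t ^ 2)) fun n => by
      rw [neg_pow ((Real.sinh t - t) / t)]
      ring
  have hsinh : Real.sinh t ≠ 0 := (Real.sinh_pos_iff.2 h0).ne'
  have hval : -(1 / (1 - -((Real.sinh t - t) / t)) ^ 2 - 1) / t ^ 2 =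
      1 / t ^ 2 - 1 / Real.sinh t ^ 2 := by
    rw [show 1 - -((Real.sinh t - t) / t) = Real.sinh t / t by field_simp; ring]
    field_simp
    ring
  have h := hsum.hasSum
  rwa [hf.unique hg', hval] at h

/-! ### Fourfold integration of the double series -/

theorem integral_sub_pow_three_mul_pow (y : ℝ) (m : ℕ) :
    ∫ t in (0 : ℝ)..y, (y - t) ^ 3 / 6 * t ^ m =
      y ^ (m + 4) / (((m : ℝ) + 1) * (m + 2) * (m + 3) * (m + 4)) := by
  have e : ∀ t : ℝ, (y - t) ^ 3 / 6 * t ^ m = y ^ 3 / 6 * t ^ m - y ^ 2 / 2 * t ^ (m + 1) +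
      y / 2 * t ^ (m + 2) - 1 / 6 * t ^ (m + 3) := fun t => by ring
  have hi : ∀ (c : ℝ) (k : ℕ), IntervalIntegrable (fun t : ℝ => c * t ^ k)
      MeasureTheory.volume 0 y := fun c k => (by fun_prop : Continuous _).intervalIntegrable _ _
  simp_rw [e]
  rw [intervalIntegral.integral_sub (((hi _ _).sub (hi _ _)).add (hi _ _)) (hi _ _),
    intervalIntegral.integral_add ((hi _ _).sub (hi _ _)) (hi _ _),
    intervalIntegral.integral_sub (hi _ _) (hi _ _)]
  simp only [intervalIntegral.integral_const_mul, integral_pow]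
  have h1 : (m : ℝ) + 1 ≠ 0 := by positivity
  have h2 : (m : ℝ) + 2 ≠ 0 := by positivity
  have h3 : (m : ℝ) + 3 ≠ 0 := by positivity
  have h4 : (m : ℝ) + 4 ≠ 0 := by positivity
  push_cast
  rw [show (m : ℝ) + 1 + 1 = m + 2 by ring, show (m : ℝ) + 2 + 1 = m + 3 by ring,
    show (m : ℝ) + 3 + 1 = m + 4 by ring]
  simp only [ne_eq, Nat.succ_ne_zero, not_false_eq_true, zero_pow, sub_zero]
  field_simp
  ring

theorem hasSum_cschCoeff_integral {y : ℝ} (h0 : 0 < y) (h1 : y ≤ 1) :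
    HasSum (fun p : ℕ × ℕ => (-1) ^ p.1 * cschCoeff p * (y ^ (2 * (p.1 + p.2) + 4) /
        ((2 * ((p.1 : ℝ) + p.2) + 1) * (2 * ((p.1 : ℝ) + p.2) + 2) *
          (2 * ((p.1 : ℝ) + p.2) + 3) * (2 * ((p.1 : ℝ) + p.2) + 4))))
      (∫ t in (0 : ℝ)..y, (y - t) ^ 3 / 6 * (1 / t ^ 2 - 1 / Real.sinh t ^ 2)) := by
  have key := intervalIntegral.hasSum_integral_of_dominated_convergence
    (μ := MeasureTheory.volume) (a := 0) (b := y)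
    (F := fun (p : ℕ × ℕ) t => (y - t) ^ 3 / 6 *
      ((-1) ^ p.1 * (cschCoeff p * t ^ (2 * (p.1 + p.2)))))
    (f := fun t => (y - t) ^ 3 / 6 * (1 / t ^ 2 - 1 / Real.sinh t ^ 2))
    -- Majorant constant in $t$: both factors are bounded using $0<t\le y$.
    (fun p _ => y ^ 3 / 6 * (cschCoeff p * y ^ (2 * (p.1 + p.2))))
    (fun p => (by fun_prop : Continuous _).aestronglyMeasurable)
    (fun p => .of_forall fun t ht => ?_)
    (.of_forall fun t ht => (summable_cschCoeff h0 h1).mul_left _)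
    intervalIntegrable_const
    (.of_forall fun t ht => ?_)
  · refine key.congr_fun fun p => ?_
    have h := integral_sub_pow_three_mul_pow y (2 * (p.1 + p.2))
    push_cast at h
    rw [← h, ← intervalIntegral.integral_const_mul]
    congr 1
    ext t
    ring
  · rw [Set.uIoc_of_le h0.le] at ht
    have a1 : 0 ≤ y - t := by linarith [ht.2]
    have a2 : y - t ≤ y := by linarith [ht.1]
    have a3 := ht.1.le
    have a4 := ht.2
    have a5 := cschCoeff_nonneg p
    rw [norm_mul, norm_mul, norm_pow, norm_neg, norm_one, one_pow, one_mul,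
      Real.norm_of_nonneg (by positivity), Real.norm_of_nonneg (by positivity)]
    gcongr
  · rw [Set.uIoc_of_le h0.le] at ht
    exact (hasSum_cschCoeff ht.1 (ht.2.trans h1)).mul_left _

/-! ### Closed form of the integral -/

theorem hasDerivAt_coth_sub_inv {t : ℝ} (ht : 0 < t) :
    HasDerivAt (fun t => Real.cosh t / Real.sinh t - 1 / t) (1 / t ^ 2 - 1 / Real.sinh t ^ 2) t := by
  have hs : Real.sinh t ≠ 0 := (Real.sinh_pos_iff.2 ht).ne'
  refine (((Real.hasDerivAt_cosh t).div (Real.hasDerivAt_sinh t) hs).sub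
    ((hasDerivAt_const t (1 : ℝ)).div (hasDerivAt_id' t) ht.ne')).congr_deriv ?_
  have := Real.cosh_sq t
  field_simp
  rw [this]
  ring

theorem hasDerivAt_log_sinh_sub_log {t : ℝ} (ht : 0 < t) :
    HasDerivAt (fun t => Real.log (Real.sinh t) - Real.log t)
      (Real.cosh t / Real.sinh t - 1 / t) t :=
  (((Real.hasDerivAt_sinh t).log (Real.sinh_pos_iff.2 ht).ne').sub
    ((hasDerivAt_id' t).log ht.ne'))

theorem hasDerivAt_exp_neg_two_mul (t : ℝ) :
    HasDerivAt (fun t : ℝ => Real.exp (-2 * t)) (-2 * Real.exp (-2 * t)) t := by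
  refine (((hasDerivAt_id' t).const_mul (-2)).exp).congr_deriv ?_
  ring

theorem exp_neg_two_mul_mem_Ioo {t : ℝ} (ht : 0 < t) :
    Real.exp (-2 * t) ∈ Set.Ioo (0 : ℝ) 1 :=
  ⟨Real.exp_pos _, Real.exp_lt_one_iff.2 (by linarith)⟩

theorem abs_exp_neg_two_mul_lt_one {t : ℝ} (ht : 0 < t) : |Real.exp (-2 * t)| < 1 := by
  rw [Real.abs_exp]
  exact (exp_neg_two_mul_mem_Ioo ht).2

/-- A primitive of `log (sinh t / t)`. -/
noncomputable def logSinhPrimitive (t : ℝ) : ℝ :=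
  t ^ 2 / 2 - t * Real.log 2 + polylog 2 (Real.exp (-2 * t)) / 2 - t * Real.log t + t

/-- A primitive of `logSinhPrimitive`. -/
noncomputable def logSinhPrimitive₂ (t : ℝ) : ℝ :=
  t ^ 3 / 6 - t ^ 2 * Real.log 2 / 2 - polylog 3 (Real.exp (-2 * t)) / 4
    - t * (t * Real.log t) / 2 + 3 * t ^ 2 / 4

theorem log_sinh {t : ℝ} (ht : 0 < t) :
    Real.log (Real.sinh t) = t - Real.log 2 + Real.log (1 - Real.exp (-2 * t)) := by
  have h : Real.sinh t = Real.exp t / 2 * (1 - Real.exp (-2 * t)) := by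
    have : Real.exp (-t) = Real.exp t * Real.exp (-2 * t) := by
      rw [← Real.exp_add]
      congr 1
      ring
    rw [Real.sinh_eq, this]
    ring
  have h2 : 1 - Real.exp (-2 * t) ≠ 0 := by linarith [(exp_neg_two_mul_mem_Ioo ht).2]
  rw [h, Real.log_mul (by positivity) h2, Real.log_div (by positivity) two_ne_zero, Real.log_exp]

theorem hasDerivAt_logSinhPrimitive {t : ℝ} (ht : 0 < t) :
    HasDerivAt logSinhPrimitive (Real.log (Real.sinh t) - Real.log t) t := by
  have hd := hasDerivAt_id' t
  refine ((((((hd.pow 2).div_const 2).sub (hd.mul_const (Real.log 2))).add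
    (((hasDerivAt_exp_neg_two_mul t).polylog (s := 1) (abs_exp_neg_two_mul_lt_one ht)
      (Real.exp_ne_zero _)).div_const 2)).sub
    (hd.mul (Real.hasDerivAt_log ht.ne'))).add hd).congr_deriv ?_
  rw [polylog_one_left (abs_exp_neg_two_mul_lt_one ht), log_sinh ht]
  field_simp
  push_cast
  ring

theorem hasDerivAt_logSinhPrimitive₂ {t : ℝ} (ht : 0 < t) :
    HasDerivAt logSinhPrimitive₂ (logSinhPrimitive t) t := by
  have hd := hasDerivAt_id' t
  have hl := hd.mul (hd.mul (Real.hasDerivAt_log ht.ne'))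
  refine ((((((hd.pow 3).div_const 6).sub (((hd.pow 2).mul_const (Real.log 2)).div_const 2)).sub
    (((hasDerivAt_exp_neg_two_mul t).polylog (s := 2) (abs_exp_neg_two_mul_lt_one ht)
      (Real.exp_ne_zero _)).div_const 4)).sub (hl.div_const 2)).add
    (((hd.pow 2).const_mul 3).div_const 4)).congr_deriv ?_
  simp only [Pi.mul_apply, logSinhPrimitive]
  field_simp
  push_cast
  ring

theorem continuousOn_polylog_exp {s : ℕ} (hs : 2 ≤ s) :
    ContinuousOn (fun t : ℝ => polylog s (Real.exp (-2 * t))) (Set.Ici 0) :=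
  ContinuousOn.polylog hs (by fun_prop) fun t ht =>
    ⟨by linarith [Real.exp_pos (-2 * t)], Real.exp_le_one_iff.2 (by linarith [Set.mem_Ici.1 ht])⟩

theorem continuousOn_logSinhPrimitive : ContinuousOn logSinhPrimitive (Set.Ici 0) := by
  have h := continuousOn_polylog_exp (le_refl 2)
  have h2 := Real.continuous_mul_log.continuousOn (s := Set.Ici 0)
  unfold logSinhPrimitive
  fun_prop

theorem continuousOn_logSinhPrimitive₂ : ContinuousOn logSinhPrimitive₂ (Set.Ici 0) := by
  have h := continuousOn_polylog_exp (show 2 ≤ 3 by norm_num)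
  have h2 := Real.continuous_mul_log.continuousOn (s := Set.Ici 0)
  unfold logSinhPrimitive₂
  fun_prop

theorem abs_coth_sub_inv_le {t : ℝ} (h0 : 0 < t) (h1 : t ≤ 1) :
    |Real.cosh t / Real.sinh t - 1 / t| ≤ 2 * t := by
  have a1 := sinh_sub_self_lt h0 h1
  have a2 : t < Real.sinh t := Real.self_lt_sinh_iff.2 h0
  have a3 := Real.one_le_cosh t
  have a4 := Real.cosh_sq t
  have hs : 0 < Real.sinh t := h0.trans a2
  have a5 : Real.sinh t < 2 * t := by nlinarith [mul_pos h0 h0]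
  -- From $(\cosh t-1)(\cosh t+1)=\sinh^2t<4t^2$ and $\cosh t+1\ge2$.
  have a6 : Real.cosh t - 1 ≤ 2 * t ^ 2 := by nlinarith
  have e : Real.cosh t / Real.sinh t - 1 / t =
      (t * Real.cosh t - Real.sinh t) / (t * Real.sinh t) := by field_simp
  have h2 : 0 < t * Real.sinh t := mul_pos h0 hs
  have h3 : 2 * t ^ 3 ≤ 2 * t * (t * Real.sinh t) := by nlinarith [mul_pos h0 h0]
  rw [e, abs_le]
  constructor
  · rw [le_div_iff₀ h2]
    nlinarith [mul_nonneg h0.le (sub_nonneg.2 a3), pow_pos h0 3]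
  · rw [div_le_iff₀ h2]
    nlinarith [mul_le_mul_of_nonneg_left a6 h0.le]

theorem continuousOn_coth_sub_inv :
    ContinuousOn (fun t => Real.cosh t / Real.sinh t - 1 / t) (Set.Ici 0) := by
  intro t ht
  rcases (Set.mem_Ici.1 ht).eq_or_lt with rfl | h
  · rw [ContinuousWithinAt]
    have hlim : Filter.Tendsto (fun t : ℝ => 2 * t) (nhdsWithin 0 (Set.Ici 0)) (nhds 0) := by
      have : Continuous fun t : ℝ => 2 * t := by fun_prop
      simpa using (this.tendsto 0).mono_left nhdsWithin_le_nhds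
    simp only [Real.sinh_zero, div_zero, sub_zero]
    refine squeeze_zero_norm' ?_ hlim
    filter_upwards [self_mem_nhdsWithin, mem_nhdsWithin_of_mem_nhds (Iio_mem_nhds one_pos)]
      with x hx hx1
    rcases (Set.mem_Ici.1 hx).eq_or_lt with rfl | h
    · simp
    · exact abs_coth_sub_inv_le h (le_of_lt hx1)
  · exact (hasDerivAt_coth_sub_inv h).continuousAt.continuousWithinAt

theorem continuousOn_log_sinh_sub_log :
    ContinuousOn (fun t => Real.log (Real.sinh t) - Real.log t) (Set.Ici 0) := by
  intro t ht
  rcases (Set.mem_Ici.1 ht).eq_or_lt with rfl | h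
  · rw [ContinuousWithinAt]
    have hlim : Filter.Tendsto (fun t : ℝ => t ^ 2) (nhdsWithin 0 (Set.Ici 0)) (nhds 0) := by
      simpa using ((continuous_pow 2).tendsto (0 : ℝ)).mono_left nhdsWithin_le_nhds
    simp only [Real.sinh_zero, sub_self]
    refine squeeze_zero_norm' ?_ hlim
    filter_upwards [self_mem_nhdsWithin, mem_nhdsWithin_of_mem_nhds (Iio_mem_nhds one_pos)]
      with x hx hx1
    rcases (Set.mem_Ici.1 hx).eq_or_lt with rfl | h
    · simp
    · have a1 := sinh_sub_self_lt h (le_of_lt hx1)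
      have a2 : x < Real.sinh x := Real.self_lt_sinh_iff.2 h
      have hs : 0 < Real.sinh x := h.trans a2
      rw [← Real.log_div hs.ne' h.ne', Real.norm_of_nonneg
        (Real.log_nonneg ((one_le_div h).2 a2.le))]
      refine (Real.log_le_sub_one_of_pos (by positivity)).trans ?_
      rw [sub_le_iff_le_add, div_le_iff₀ h]
      nlinarith
  · exact (hasDerivAt_log_sinh_sub_log h).continuousAt.continuousWithinAt

/-- Repeated integration by parts, packed into one primitive `W`. At $t=y$ only the last term of `W`
survives; at $t=0$ the first two vanish and the others give $\mathrm{Li}_2(1)=\pi^2/6$ and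
$\mathrm{Li}_3(1)$. -/
theorem integral_sub_pow_three_mul_csch {y : ℝ} (hy : 0 < y) :
    ∫ t in (0 : ℝ)..y, (y - t) ^ 3 / 6 * (1 / t ^ 2 - 1 / Real.sinh t ^ 2) =
      logSinhPrimitive₂ y - y * Real.pi ^ 2 / 12 + polylog 3 1 / 4 := by
  set W : ℝ → ℝ := fun t =>
    (y - t) ^ 3 / 6 * (Real.cosh t / Real.sinh t - 1 / t) +
      (y - t) ^ 2 / 2 * (Real.log (Real.sinh t) - Real.log t) +
      (y - t) * logSinhPrimitive t + logSinhPrimitive₂ t with hW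
  have hsub : Set.Icc 0 y ⊆ Set.Ici 0 := fun t ht => ht.1
  have hc : ContinuousOn W (Set.Icc 0 y) := by
    have c1 := continuousOn_coth_sub_inv.mono hsub
    have c2 := continuousOn_log_sinh_sub_log.mono hsub
    have c3 := continuousOn_logSinhPrimitive.mono hsub
    have c4 := continuousOn_logSinhPrimitive₂.mono hsub
    exact (((ContinuousOn.mul (by fun_prop) c1).add (ContinuousOn.mul (by fun_prop) c2)).add
      (ContinuousOn.mul (by fun_prop) c3)).add c4
  have hd : ∀ t ∈ Set.Ioo 0 y,
      HasDerivAt W ((y - t) ^ 3 / 6 * (1 / t ^ 2 - 1 / Real.sinh t ^ 2)) t := by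
    intro t ht
    have hs := (hasDerivAt_id' t).const_sub y
    refine ((((((hs.pow 3).div_const 6).mul (hasDerivAt_coth_sub_inv ht.1)).add
      (((hs.pow 2).div_const 2).mul (hasDerivAt_log_sinh_sub_log ht.1))).add
      (hs.mul (hasDerivAt_logSinhPrimitive ht.1))).add
      (hasDerivAt_logSinhPrimitive₂ ht.1)).congr_deriv ?_
    simp only [Pi.pow_apply]
    push_cast
    ring
  have hi : IntervalIntegrable
      (fun t => (y - t) ^ 3 / 6 * (1 / t ^ 2 - 1 / Real.sinh t ^ 2)) MeasureTheory.volume 0 y := by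
    -- Integrability comes from the sign of the integrand ($\sinh t\ge t$), with no bound near $0$
    -- required.
    refine intervalIntegral.intervalIntegrable_deriv_of_nonneg (g := W)
      (by rwa [Set.uIcc_of_le hy.le]) (by rwa [min_eq_left hy.le, max_eq_right hy.le])
      fun t ht => ?_
    rw [min_eq_left hy.le, max_eq_right hy.le] at ht
    have h1 : 0 ≤ y - t := by linarith [ht.2]
    have h2 := ht.1
    have h3 : t ≤ Real.sinh t := Real.self_le_sinh_iff.2 h2.le
    refine mul_nonneg (by positivity) (sub_nonneg.2 ?_)
    gcongr
  rw [intervalIntegral.integral_eq_sub_of_hasDerivAt_of_le hy.le hc hd hi]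
  simp [hW, logSinhPrimitive, logSinhPrimitive₂, polylog_two_one]
  ring

/-! ### Assembling the identity for $\zeta(3)$ -/

/-- The $\sqrt6$ in the argument produces $6^{-(n+i+2)}$, which meets the $6^{n+1+i}$ in $P$ and
leaves $1/6$; the factor $n+1$ cancels the denominator in `zetaP_eq_coeff`. -/
theorem zetaCoeffTerm_mul_pow (L : ℝ) (i n : ℕ) :
    zetaCoeffTerm (L / (2 * √6)) (i + 1) (n + 1) * (L / (2 * √6)) ^ (2 * (i + 1)) =
      1 / 6 * ((-1) ^ n * cschCoeff (n, i) * ((L / 2) ^ (2 * (n + i) + 4) /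
        ((2 * ((n : ℝ) + i) + 1) * (2 * ((n : ℝ) + i) + 2) *
          (2 * ((n : ℝ) + i) + 3) * (2 * ((n : ℝ) + i) + 4)))) := by
  have h6 : (L / (2 * √6)) ^ 2 = (L / 2) ^ 2 / 6 := by
    rw [div_pow, mul_pow, Real.sq_sqrt (by norm_num)]
    ring
  rw [zetaCoeffTerm, show n + 1 + (i + 1) - 1 = n + 1 + i by omega, zetaP_eq_coeff, cschCoeff,
    pow_mul, pow_mul, h6, show 2 * (n + i) + 4 = 2 * (n + i + 2) by ring,
    pow_mul]
  push_cast
  have e1 : 2 * ((n : ℝ) + 1) + 2 * (i + 1) - 3 = 2 * ((n : ℝ) + i) + 1 := by ring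
  have e2 : 2 * ((n : ℝ) + 1) + 2 * (i + 1) - 2 = 2 * ((n : ℝ) + i) + 2 := by ring
  have e3 : 2 * ((n : ℝ) + 1) + 2 * (i + 1) - 1 = 2 * ((n : ℝ) + i) + 3 := by ring
  have e4 : 2 * ((n : ℝ) + 1) + 2 * (i + 1) = 2 * ((n : ℝ) + i) + 4 := by ring
  rw [e1, e2, e3, e4]
  generalize PowerSeries.coeff i (sinhTail ^ (n + 1)) = c
  generalize ((L / 2) ^ 2) = w
  rw [div_pow, div_pow]
  have h1 : 2 * ((n : ℝ) + i) + 1 ≠ 0 := by positivity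
  have h2 : 2 * ((n : ℝ) + i) + 2 ≠ 0 := by positivity
  have h3 : 2 * ((n : ℝ) + i) + 3 ≠ 0 := by positivity
  have h4 : 2 * ((n : ℝ) + i) + 4 ≠ 0 := by positivity
  field_simp
  ring

theorem hasSum_zetaCoeffTerm {L : ℝ} (h0 : 0 < L) (h1 : L ≤ 2) :
    HasSum (fun p : ℕ × ℕ => zetaCoeffTerm (L / (2 * √6)) (p.1 + 1) (p.2 + 1) *
        (L / (2 * √6)) ^ (2 * (p.1 + 1)))
      ((logSinhPrimitive₂ (L / 2) - L / 2 * Real.pi ^ 2 / 12 + polylog 3 1 / 4) / 6) := by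
  have h := (hasSum_cschCoeff_integral (half_pos h0) (by linarith)).mul_left (1 / 6)
  rw [integral_sub_pow_three_mul_csch (half_pos h0), one_div_mul_eq_div] at h
  -- The expansion sums over the power of $u$ outermost, the theorem over $i$; absolute convergence
  -- permits the swap.
  refine ((Equiv.prodComm ℕ ℕ).hasSum_iff.2 h).congr_fun fun p => ?_
  exact zetaCoeffTerm_mul_pow L p.1 p.2

theorem summable_zetaCoeffTerm {L : ℝ} (h0 : 0 < L) (h1 : L ≤ 2) {i : ℕ} (hi : 1 ≤ i) :
    Summable fun n => zetaCoeffTerm (L / (2 * √6)) i (n + 1) := by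
  obtain ⟨j, rfl⟩ := Nat.exists_eq_add_of_le' hi
  have h : Summable fun n => zetaCoeffTerm (L / (2 * √6)) (j + 1) (n + 1) *
      (L / (2 * √6)) ^ (2 * (j + 1)) := (hasSum_zetaCoeffTerm h0 h1).summable.prod_factor j
  refine (h.mul_right ((L / (2 * √6)) ^ (2 * (j + 1)))⁻¹).congr fun n => ?_
  exact mul_inv_cancel_right₀ (by positivity) _

theorem hasSum_zetaCoeff {L : ℝ} (h0 : 0 < L) (h1 : L ≤ 2) :
    HasSum (fun i => zetaCoeff (L / (2 * √6)) (i + 1) * (L / (2 * √6)) ^ (2 * (i + 1)))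
      ((logSinhPrimitive₂ (L / 2) - L / 2 * Real.pi ^ 2 / 12 + polylog 3 1 / 4) / 6) :=
  (hasSum_zetaCoeffTerm h0 h1).prod_fiberwise fun i =>
    (summable_zetaCoeffTerm h0 h1 (Nat.le_add_left 1 i)).hasSum.mul_right _

theorem hasSum_zetaCoeff_log {x : ℝ} (h0 : 1 < x) (h1 : x ≤ 3) :
    HasSum (fun i => zetaCoeff (zetaArg x) (i + 1) * zetaArg x ^ (2 * (i + 1)))
      ((Real.log x ^ 3 / 48 - Real.log x ^ 2 * Real.log 2 / 8 - polylog 3 x⁻¹ / 4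
        - Real.log x ^ 2 * (Real.log (Real.log x) - Real.log 2) / 8 + 3 * Real.log x ^ 2 / 16
        - Real.log x * Real.pi ^ 2 / 24 + polylog 3 1 / 4) / 6) := by
  have hL := Real.log_pos h0
  have h := hasSum_zetaCoeff hL
    -- $\ln x\le x-1\le2$ puts $y=\frac12\ln x$ in $(0,1]$, where the double series was shown to
    -- converge.
    ((Real.log_le_sub_one_of_pos (by linarith)).trans (by linarith))
  have e : -2 * (Real.log x / 2) = -Real.log x := by ring
  rw [logSinhPrimitive₂, e, Real.exp_neg, Real.exp_log (by linarith),
    Real.log_div hL.ne' two_ne_zero] at h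
  unfold zetaArg
  convert h using 1
  ring

theorem mainTheorem6 :
    (∀ i : ℕ, 1 ≤ i →
      Summable (fun n : ℕ => zetaCoeffTerm (zetaArg (3 / 2)) i (n + 1)) ∧
      Summable (fun n : ℕ => zetaCoeffTerm (zetaArg (4 / 3)) i (n + 1)) ∧
      Summable (fun n : ℕ => zetaCoeffTerm (zetaArg (9 / 8)) i (n + 1))) ∧
    Summable (fun i : ℕ => zetaA (i + 1) * zetaArg (3 / 2) ^ (2 * (i + 1))) ∧
    Summable (fun i : ℕ => zetaB (i + 1) * zetaArg (4 / 3) ^ (2 * (i + 1))) ∧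
    Summable (fun i : ℕ => zetaC (i + 1) * zetaArg (9 / 8) ^ (2 * (i + 1))) ∧
    riemannZeta 3 =
      ((2 * Real.pi ^ 2 / 5 * Real.log 3
        - 54 / 5 * Real.log (3 / 2) ^ 2
        - 27 / 5 * Real.log (4 / 3) ^ 2
        + 9 / 5 * Real.log (9 / 8) ^ 2
        - 6 / 5 * Real.log (3 / 2) ^ 3
        + Real.log (4 / 3) ^ 3
        + 1 / 5 * Real.log (9 / 8) ^ 3
        + 28 / 5 * Real.log 2 ^ 3
        - 4 / 5 * Real.log 3 ^ 3
        - 4 / 5 * Real.log (3 / 2) ^ 3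
        + 12 / 5 * Real.log 3 * Real.log (3 / 2) ^ 2
        - 24 / 5 * Real.log (4 / 3) * Real.log 2 ^ 2
        + 36 / 5 * Real.log (3 / 2) ^ 2 * Real.log (Real.log (3 / 2))
        + 18 / 5 * Real.log (4 / 3) ^ 2 * Real.log (Real.log (4 / 3))
        - 6 / 5 * Real.log (9 / 8) ^ 2 * Real.log (Real.log (9 / 8))
        + 1728 / 5 * (∑' i : ℕ, zetaA (i + 1) * zetaArg (3 / 2) ^ (2 * (i + 1)))
        + 864 / 5 * (∑' i : ℕ, zetaB (i + 1) * zetaArg (4 / 3) ^ (2 * (i + 1)))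
        - 288 / 5 * (∑' i : ℕ, zetaC (i + 1) * zetaArg (9 / 8) ^ (2 * (i + 1))) : ℝ) : ℂ) := by
  have b1 : Real.log (3 / 2) = Real.log 3 - Real.log 2 :=
    Real.log_div three_ne_zero two_ne_zero
  have h4 : Real.log 4 = 2 * Real.log 2 := by
    rw [show (4 : ℝ) = 2 ^ 2 by norm_num, Real.log_pow]
    norm_num
  have b2 : Real.log (4 / 3) = 2 * Real.log 2 - Real.log 3 := by
    rw [Real.log_div four_ne_zero three_ne_zero, h4]
  have b3 : Real.log (9 / 8) = 2 * Real.log 3 - 3 * Real.log 2 := by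
    rw [show (9 / 8 : ℝ) = 3 ^ 2 / 2 ^ 3 by norm_num, Real.log_div (by norm_num) (by norm_num),
      Real.log_pow, Real.log_pow]
    norm_num
  have s1 := hasSum_zetaCoeff_log (x := 3 / 2) (by norm_num) (by norm_num)
  have s2 := hasSum_zetaCoeff_log (x := 4 / 3) (by norm_num) (by norm_num)
  have s3 := hasSum_zetaCoeff_log (x := 9 / 8) (by norm_num) (by norm_num)
  have hp : ∀ {x : ℝ}, 1 < x → x ≤ 3 → ∀ i : ℕ, 1 ≤ i →
      Summable fun n : ℕ => zetaCoeffTerm (zetaArg x) i (n + 1) := fun h0 h1 i hi =>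
    summable_zetaCoeffTerm (Real.log_pos h0)
      ((Real.log_le_sub_one_of_pos (by linarith)).trans (by linarith)) hi
  refine ⟨fun i hi => ⟨hp (by norm_num) (by norm_num) i hi, hp (by norm_num) (by norm_num) i hi,
    hp (by norm_num) (by norm_num) i hi⟩, s1.summable, s2.summable, s3.summable, ?_⟩
  have hz := riemannZeta_eq_polylog_one (s := 3) (by norm_num)
  have hz' : riemannZeta 3 = ((polylog 3 1 : ℝ) : ℂ) := by exact_mod_cast hz
  rw [hz', Complex.ofReal_inj]
  unfold zetaA zetaB zetaC
  rw [s1.tsum_eq, s2.tsum_eq, s3.tsum_eq]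
  have key := trilog_two_thirds_combination
  rw [inv_div, inv_div, inv_div]
  generalize Real.log (Real.log (3 / 2)) = u
  generalize Real.log (Real.log (4 / 3)) = v
  generalize Real.log (Real.log (9 / 8)) = w
  rw [b1, b2, b3]
  -- The three sums contribute $-\frac{72}5,-\frac{36}5,+\frac{12}5$ times $\mathrm{Li}_3$ at
  -- $\frac23,\frac34,\frac89$, which is $-\frac{12}5$ times the left side of `key`.
  linear_combination (12 / 5) * key
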